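/- Lemma (prequantization on a symplectic manifold). Let $(M,\Omega)$ be a symplectic manifold of dimension $2n$ ($M$ Hausdorff and second countable, $\Omega$ a closed nondegenerate smooth 2-form) and let $\hbar>0$. For $f\in C^\infty(M,\mathbb{R})$ let $X_f$ be the Hamiltonian vector field, defined by $\Omega(X_f,\cdot)=-\mathrm{d}f$, and put $\{f,g\}:=\Omega(X_f,X_g)$. Let $L\to M$ be a smooth complex line bundle with a Hermitian metric $h$ and a connection $\nabla$, that is, a map $(X,s)\mapsto\nabla_Xs$ from $\Gamma(M,TM)\times\Gamma(M,L)$ to $\Gamma(M,L)$ which is $C^\infty(M,\mathbb{R})$-linear in $X$, $\mathbb{C}$-linear in $s$, and satisfies $\nabla_X(us)=X(u)s+u\nabla_Xs$ for all $u\in C^\infty(M,\mathbb{C})$. Suppose that $(L,\nabla,h)$ is a prequantum line bundle, i.e. its curvature $R^\nabla(X,Y):=\mathrm{i}\,(\nabla_X\nabla_Y-\nabla_Y\nabla_X-\nabla_{[X,Y]})$ satisfies $R^\nabla(X,Y)s=\frac1\hbar\Omega(X,Y)\,s$ for all vector fields $X,Y$ and all smooth sections $s$. For $f\in C^\infty(M,\mathbb{R})$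 let $\mathscr{Q}_{pre}(f):=-\mathrm{i}\hbar\nabla_{X_f}+f$, acting on $\Gamma(M,L)$. Then for all $f,g\in C^\infty(M,\mathbb{R})$ and every smooth section $s$ of $L$ that is square-integrable, i.e. $\int_M h(s,s)\,\frac{\Omega^{\wedge n}}{n!}<\infty$, $$\frac{\mathrm{i}}{\hbar}\,\big[\mathscr{Q}_{pre}(f),\mathscr{Q}_{pre}(g)\big]s=\mathscr{Q}_{pre}(\{f,g\})\,s ,$$ where $[A,B]=AB-BA$ is the commutator of operators on $\Gamma(M,L)$. -/

import Mathlib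

open scoped Manifold ContDiff Bundle

namespace Prequantization

/-- The model space `ℝ²ⁿ`. -/
abbrev ModelSpace (n : ℕ) : Type := EuclideanSpace ℝ (Fin (2 * n))

section Base

variable (n : ℕ) (M : Type*) [TopologicalSpace M] [ChartedSpace (ModelSpace n) M]

/-- `C^∞(M, ℝ)`. -/
abbrev SmoothFunction : Type _ := C^∞⟮𝓡 (2 * n), M; 𝓘(ℝ, ℝ), ℝ⟯

/-- `C^∞(M, ℂ)`. -/
abbrev ComplexSmoothFunction : Type _ := C^∞⟮𝓡 (2 * n), M; 𝓘(ℝ, ℂ), ℂ⟯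

/-- `Γ(M, TM)`. -/
abbrev SmoothVectorField [IsManifold (𝓡 (2 * n)) ∞ M] : Type _ :=
  Cₛ^∞⟮𝓡 (2 * n); ModelSpace n, (TangentSpace (𝓡 (2 * n)) : M → Type)⟯

variable {n M}

/-- A real smooth function as a complex-valued one. -/
noncomputable def SmoothFunction.toComplex (f : SmoothFunction n M) :
    ComplexSmoothFunction n M :=
  ⟨fun x => (f x : ℂ), Complex.ofRealCLM.contDiff.contMDiff.comp f.contMDiff⟩

variable [IsManifold (𝓡 (2 * n)) ∞ M]

/-- The vector field `f X`. -/
noncomputable def SmoothVectorField.smul (f : SmoothFunction n M) (X : SmoothVectorField n M) :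
    SmoothVectorField n M :=
  ⟨fun x => f x • X x, f.contMDiff.smul_section X.contMDiff⟩

/-- The Lie bracket `[X, Y] = XY - YX`. -/
noncomputable def SmoothVectorField.bracket (X Y : SmoothVectorField n M) :
    SmoothVectorField n M :=
  ⟨VectorField.mlieBracket (𝓡 (2 * n)) X Y, fun x =>
    haveI : IsManifold (𝓡 (2 * n)) (minSmoothness ℝ 2) M :=
      IsManifold.of_le (n := ∞) (by simpa using ENat.LEInfty.out)
    haveI : IsManifold (𝓡 (2 * n)) (((⊤ : ℕ∞) : ℕ∞ω) + 1) M :=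
      IsManifold.of_le (n := ∞) (by simp)
    ContMDiffAt.mlieBracket_vectorField (m := (⊤ : ℕ∞)) (n := (⊤ : ℕ∞)) (X.contMDiff x)
      (Y.contMDiff x) (by simp)⟩

variable (n M) in
/-- A symplectic form: a smooth, alternating, nondegenerate 2-form `Ω` with `dΩ = 0`, where
`dΩ(X, Y, Z) = X(Ω(Y, Z)) - Y(Ω(X, Z)) + Z(Ω(X, Y)) - Ω([X, Y], Z) + Ω([X, Z], Y) - Ω([Y, Z], X)`;
`mvfderiv I f x` is the differential `df` at `x`. -/
structure SymplecticForm where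
  toFun : ∀ x : M, TangentSpace (𝓡 (2 * n)) x →L[ℝ] TangentSpace (𝓡 (2 * n)) x →L[ℝ] ℝ
  contMDiff_toFun : ContMDiff (𝓡 (2 * n))
    ((𝓡 (2 * n)).prod 𝓘(ℝ, ModelSpace n →L[ℝ] ModelSpace n →L[ℝ] ℝ)) ∞
    (fun x => Bundle.TotalSpace.mk' (ModelSpace n →L[ℝ] ModelSpace n →L[ℝ] ℝ)
      (E := fun x : M => TangentSpace (𝓡 (2 * n)) x →L[ℝ] TangentSpace (𝓡 (2 * n)) x →L[ℝ] ℝ)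
      x (toFun x))
  alternating : ∀ (x : M) (v : TangentSpace (𝓡 (2 * n)) x), toFun x v v = 0
  nondegenerate : ∀ (x : M) (v : TangentSpace (𝓡 (2 * n)) x), (∀ w, toFun x v w = 0) → v = 0
  closed : ∀ (X Y Z : SmoothVectorField n M) (x : M),
    mvfderiv (𝓡 (2 * n)) (fun y => toFun y (Y y) (Z y)) x (X x)
      - mvfderiv (𝓡 (2 * n)) (fun y => toFun y (X y) (Z y)) x (Y x)
      + mvfderiv (𝓡 (2 * n)) (fun y => toFun y (X y) (Y y)) x (Z x)
      - toFun x (X.bracket Y x) (Z x)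
      + toFun x (X.bracket Z x) (Y x)
      - toFun x (Y.bracket Z x) (X x) = 0


/-- The differential of a smooth function is a smooth 1-form. -/
lemma contMDiff_mvfderiv (f : SmoothFunction n M) :
    ContMDiff (𝓡 (2 * n)) ((𝓡 (2 * n)).prod 𝓘(ℝ, ModelSpace n →L[ℝ] ℝ)) ∞
      (fun x => Bundle.TotalSpace.mk' (ModelSpace n →L[ℝ] ℝ)
        (E := fun x : M => TangentSpace (𝓡 (2 * n)) x →L[ℝ] ℝ) x
        (mvfderiv (𝓡 (2 * n)) f x)) := by
  intro x₀
  rw [contMDiffAt_hom_bundle]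
  refine ⟨contMDiffAt_id, ?_⟩
  have h := (f.contMDiff x₀).mfderiv_const (m := ∞) (by simp)
  refine h.congr_of_eventuallyEq (Filter.Eventually.of_forall fun x => ?_)
  ext v
  simp [inTangentCoordinates, ContinuousLinearMap.inCoordinates, mvfderiv]
  rfl

/-- By nondegeneracy, `v ↦ Ω(v, ·)` is an isomorphism from the tangent to the cotangent space. -/
lemma SymplecticForm.isInvertible (Ω : SymplecticForm n M) (x : M) :
    (Ω.toFun x).IsInvertible := by
  have : FiniteDimensional ℝ (TangentSpace (𝓡 (2 * n)) x) :=
    inferInstanceAs (FiniteDimensional ℝ (ModelSpace n))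
  have : T2Space (TangentSpace (𝓡 (2 * n)) x) := inferInstanceAs (T2Space (ModelSpace n))
  have hinj : Function.Injective (Ω.toFun x) := by
    rw [injective_iff_map_eq_zero]
    intro v hv
    exact Ω.nondegenerate x v fun w => by rw [hv]; rfl
  let φ : ModelSpace n →ₗ[ℝ] (ModelSpace n →L[ℝ] ℝ) := (Ω.toFun x).toLinearMap
  have hr : Module.finrank ℝ (ModelSpace n) = Module.finrank ℝ (ModelSpace n →L[ℝ] ℝ) := by
    rw [(LinearMap.toContinuousLinearMap (𝕜 := ℝ) (E := ModelSpace n) (F' := ℝ)).symm.finrank_eq]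
    exact Subspace.dual_finrank_eq.symm
  exact ⟨((LinearEquiv.ofInjectiveOfFinrankEq φ hinj hr).toContinuousLinearEquiv), rfl⟩

lemma SymplecticForm.contMDiff_inverse (Ω : SymplecticForm n M) (f : SmoothFunction n M) :
    ContMDiff (𝓡 (2 * n)) ((𝓡 (2 * n)).prod 𝓘(ℝ, ModelSpace n)) ∞
      (fun x => Bundle.TotalSpace.mk' (ModelSpace n) (E := TangentSpace (𝓡 (2 * n))) x
        ((Ω.toFun x).inverse (mvfderiv (𝓡 (2 * n)) f x))) := by
  intro x₀
  refine ContMDiffAt.clm_apply_of_inCoordinates (F₁ := ModelSpace n →L[ℝ] ℝ)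
    (E₁ := fun x : M => TangentSpace (𝓡 (2 * n)) x →L[ℝ] ℝ) (b₁ := id) (b₂ := id)
    (ϕ := fun x => (Ω.toFun x).inverse) ?_ (contMDiff_mvfderiv f x₀) contMDiffAt_id
  have h := Ω.contMDiff_toFun x₀
  rw [contMDiffAt_hom_bundle] at h
  have h2 := h.2
  set A : M → (ModelSpace n →L[ℝ] (ModelSpace n →L[ℝ] ℝ)) := fun x =>
    ContinuousLinearMap.inCoordinates (ModelSpace n) (TangentSpace (𝓡 (2 * n)) : M → Type)
      (ModelSpace n →L[ℝ] ℝ) (fun x : M => TangentSpace (𝓡 (2 * n)) x →L[ℝ] ℝ) x₀ x x₀ x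
      (Ω.toFun x) with hA
  have hev : ∀ᶠ x in nhds x₀,
      x ∈ (trivializationAt (ModelSpace n) (TangentSpace (𝓡 (2 * n)) : M → Type) x₀).baseSet ∧
      x ∈ (trivializationAt (ModelSpace n →L[ℝ] ℝ)
        (fun x : M => TangentSpace (𝓡 (2 * n)) x →L[ℝ] ℝ) x₀).baseSet :=
    Filter.inter_mem ((trivializationAt _ _ x₀).open_baseSet.mem_nhds
      (FiberBundle.mem_baseSet_trivializationAt' x₀)) ((trivializationAt _ _ x₀).open_baseSet.mem_nhds
      (FiberBundle.mem_baseSet_trivializationAt' x₀))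
  have hAinv : (A x₀).IsInvertible := by
    obtain ⟨h1, h2⟩ := hev.self_of_nhds
    rw [hA]; beta_reduce
    rw [ContinuousLinearMap.inCoordinates_eq h1 h2]
    obtain ⟨e, he⟩ := Ω.isInvertible x₀
    rw [← he]
    exact ⟨((ContinuousLinearEquiv.symm _).trans e).trans _, rfl⟩
  have h3 : ContMDiffAt (𝓡 (2 * n)) 𝓘(ℝ, (ModelSpace n →L[ℝ] ℝ) →L[ℝ] ModelSpace n) ∞
      (fun x => (A x).inverse) x₀ :=
    (hAinv.contDiffAt_map_inverse).contMDiffAt.comp x₀ h2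
  refine h3.congr_of_eventuallyEq ?_
  filter_upwards [hev] with x hx
  rw [hA]; beta_reduce
  rw [ContinuousLinearMap.inCoordinates_eq hx.1 hx.2]
  obtain ⟨e, he⟩ := Ω.isInvertible x
  rw [← he]
  simp only [id_eq]
  rw [ContinuousLinearMap.inCoordinates_eq hx.2 hx.1]
  simp
  rfl

/-- The Hamiltonian vector field `X_f`, i.e. the unique vector field with `Ω(X_f, ·) = -df`. -/
noncomputable def SymplecticForm.hamiltonianVectorField (Ω : SymplecticForm n M)
    (f : SmoothFunction n M) : SmoothVectorField n M :=
  -⟨fun x => (Ω.toFun x).inverse (mvfderiv (𝓡 (2 * n)) f x), Ω.contMDiff_inverse f⟩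

/-- The defining property of the Hamiltonian vector field. -/
lemma SymplecticForm.hamiltonianVectorField_spec (Ω : SymplecticForm n M)
    (f : SmoothFunction n M) (x : M) (v : TangentSpace (𝓡 (2 * n)) x) :
    Ω.toFun x (Ω.hamiltonianVectorField f x) v = -mvfderiv (𝓡 (2 * n)) f x v := by
  have h : Ω.hamiltonianVectorField f x
      = -(Ω.toFun x).inverse (mvfderiv (𝓡 (2 * n)) f x) := rfl
  obtain ⟨e, he⟩ := Ω.isInvertible x
  rw [h, map_neg, ← he, ContinuousLinearMap.inverse_equiv]
  simp

/-- The Poisson bracket `{f, g} = Ω(X_f, X_g)`. -/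
noncomputable def SymplecticForm.poissonBracket (Ω : SymplecticForm n M)
    (f g : SmoothFunction n M) : SmoothFunction n M :=
  ⟨fun x => Ω.toFun x (Ω.hamiltonianVectorField f x) (Ω.hamiltonianVectorField g x), by
    have h : ContMDiff (𝓡 (2 * n)) ((𝓡 (2 * n)).prod 𝓘(ℝ, ℝ)) ∞ (fun x =>
        Bundle.TotalSpace.mk' ℝ (E := Bundle.Trivial M ℝ) x (Ω.toFun x
          (Ω.hamiltonianVectorField f x) (Ω.hamiltonianVectorField g x))) :=
      ContMDiff.clm_bundle_apply₂ (F₁ := ModelSpace n) (F₂ := ModelSpace n)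
        Ω.contMDiff_toFun (Ω.hamiltonianVectorField f).contMDiff
        (Ω.hamiltonianVectorField g).contMDiff
    intro x
    have hx := h x
    simp only [Bundle.contMDiffAt_totalSpace] at hx
    exact hx.2⟩

/-- The Liouville volume form `λ = (1/n!) Ω ∧ ⋯ ∧ Ω` (`n` factors) evaluated on `2n` tangent
vectors at `x`, written out: the `n`-fold wedge power of `Ω` is
`2⁻ⁿ ∑_σ sign(σ) ∏_i Ω(v_{σ(2i)}, v_{σ(2i+1)})`. -/
noncomputable def SymplecticForm.liouvilleForm (Ω : SymplecticForm n M) (x : M)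
    (v : Fin (2 * n) → TangentSpace (𝓡 (2 * n)) x) : ℝ :=
  ((n.factorial : ℝ) * 2 ^ n)⁻¹ * ∑ σ : Equiv.Perm (Fin (2 * n)),
    ((Equiv.Perm.sign σ : ℤ) : ℝ) *
      ∏ i : Fin n, Ω.toFun x (v (σ ⟨2 * i, by omega⟩)) (v (σ ⟨2 * i + 1, by omega⟩))

/-- The measure of the Liouville volume form on the domain of the preferred chart `φ` at `p`,
extended by zero to `M`: the image under `φ⁻¹` of the measure on the target of `φ` with density
`|λ(∂₁, …, ∂₂ₙ)|`, where `∂ᵢ = d(φ⁻¹)(eᵢ)` are the coordinate vector fields of `φ`. -/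
noncomputable def SymplecticForm.chartLiouvilleMeasure [MeasurableSpace M]
    (Ω : SymplecticForm n M) (p : M) : MeasureTheory.Measure M :=
  MeasureTheory.Measure.map (chartAt (ModelSpace n) p).symm
    ((MeasureTheory.volume.restrict (chartAt (ModelSpace n) p).target).withDensity fun y =>
      ENNReal.ofReal |Ω.liouvilleForm ((chartAt (ModelSpace n) p).symm y) fun i =>
        mfderiv (𝓡 (2 * n)) (𝓡 (2 * n)) (chartAt (ModelSpace n) p).symm y
          (EuclideanSpace.single i (1 : ℝ) : ModelSpace n)|)

/-- The Liouville measure, i.e. integration against the volume form `λ = (1/n!) Ω ∧ ⋯ ∧ Ω` (`M` is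
oriented by `λ`). The chart measures agree on overlaps and countably many chart domains cover `M`,
so their supremum is the measure on `M` that restricts to each of them. -/
noncomputable def SymplecticForm.liouvilleMeasure [MeasurableSpace M]
    (Ω : SymplecticForm n M) : MeasureTheory.Measure M :=
  ⨆ p : M, Ω.chartLiouvilleMeasure p

end Base

section LineBundle

/- A smooth complex line bundle over `M` is a fiber bundle `L` with model fiber `ℂ`, complex linear
trivializations (`VectorBundle ℂ ℂ L`), and coordinate changes that are smooth over the real
manifold `M` (`ContMDiffVectorBundle ∞ ℂ L`, which refers to the underlying real bundle). -/
variable {n : ℕ} {M : Type*} [TopologicalSpace M] [ChartedSpace (ModelSpace n) M]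
  [IsManifold (𝓡 (2 * n)) ∞ M]
  (L : M → Type*) [∀ x, AddCommGroup (L x)] [∀ x, Module ℂ (L x)] [∀ x, TopologicalSpace (L x)]
  [TopologicalSpace (Bundle.TotalSpace ℂ L)] [FiberBundle ℂ L] [VectorBundle ℂ ℂ L]
  [VectorBundle ℝ ℂ L] [ContMDiffVectorBundle ∞ ℂ L (𝓡 (2 * n))]

variable (n) in
/-- The space `Γ(M, L)` of smooth sections of `L`. -/
abbrev SmoothSection : Type _ := Cₛ^∞⟮𝓡 (2 * n); ℂ, L⟯

variable {L}

lemma contMDiff_smul_section (g : ComplexSmoothFunction n M) (s : SmoothSection n L) :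
    ContMDiff (𝓡 (2 * n)) ((𝓡 (2 * n)).prod 𝓘(ℝ, ℂ)) ∞
      (fun x => Bundle.TotalSpace.mk' ℂ x (g x • s x)) := by
  intro x₀
  have hs := s.contMDiff x₀
  rw [Bundle.contMDiffAt_section] at hs ⊢
  set e := trivializationAt ℂ L x₀
  have hmul : ContMDiffAt (𝓡 (2 * n)) 𝓘(ℝ, ℂ) ∞ (fun x => g x * (e ⟨x, s x⟩).2) x₀ :=
    (contDiff_mul (𝕜 := ℝ) (𝔸 := ℂ) (n := ∞)).contMDiff.contMDiffAt.comp x₀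
      ((g.contMDiff x₀).prodMk_space hs)
  refine hmul.congr_of_eventuallyEq ?_
  filter_upwards [e.open_baseSet.mem_nhds (FiberBundle.mem_baseSet_trivializationAt' x₀)] with x hx
  exact (e.linear ℂ hx).map_smul (g x) (s x)

/-- Multiplication of sections by smooth complex functions. -/
noncomputable instance : SMul (ComplexSmoothFunction n M) (SmoothSection n L) :=
  ⟨fun g s => ⟨fun x => g x • s x, contMDiff_smul_section g s⟩⟩

noncomputable instance : SMul ℂ (SmoothSection n L) :=
  ⟨fun c s => ⟨fun x => c • s x, contMDiff_smul_section ⟨fun _ => c, contMDiff_const⟩ s⟩⟩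

/-- `Γ(M, L)` is a complex vector space, with the pointwise operations. -/
noncomputable instance : Module ℂ (SmoothSection n L) where
  one_smul s := ContMDiffSection.ext fun x => one_smul ℂ (s x)
  mul_smul a b s := ContMDiffSection.ext fun x => mul_smul a b (s x)
  smul_zero a := ContMDiffSection.ext fun _ => smul_zero a
  smul_add a s t := ContMDiffSection.ext fun x => smul_add a (s x) (t x)
  add_smul a b s := ContMDiffSection.ext fun x => add_smul a b (s x)
  zero_smul s := ContMDiffSection.ext fun x => zero_smul ℂ (s x)

/-- The operator on `Γ(M, L)` of multiplication by a real smooth function. -/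
noncomputable def mulOperator (f : SmoothFunction n M) : Module.End ℂ (SmoothSection n L) where
  toFun s := f.toComplex • s
  map_add' s t := ContMDiffSection.ext fun x => smul_add (f x : ℂ) (s x) (t x)
  map_smul' c s := ContMDiffSection.ext fun x => smul_comm (f x : ℂ) c (s x)

variable (n L) in
/-- A Hermitian metric on `L`: a smooth family of positive definite Hermitian forms on the fibers,
conjugate linear in the first argument. -/
structure HermitianMetric where
  toFun : ∀ x : M, L x →ₗ⋆[ℂ] L x →ₗ[ℂ] ℂ
  hermitian : ∀ (x : M) (v w : L x), (starRingEnd ℂ) (toFun x v w) = toFun x w v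
  pos : ∀ (x : M) (v : L x), v ≠ 0 → 0 < (toFun x v v).re
  smooth : ∀ s t : SmoothSection n L,
    ContMDiff (𝓡 (2 * n)) 𝓘(ℝ, ℂ) ∞ fun x => toFun x (s x) (t x)

variable (n L) in
/-- A connection on `L`; `toFun X s` is `∇_X s`. -/
structure Connection where
  toFun : SmoothVectorField n M → SmoothSection n L →ₗ[ℂ] SmoothSection n L
  map_add : ∀ (X Y : SmoothVectorField n M) (s : SmoothSection n L),
    toFun (X + Y) s = toFun X s + toFun Y s
  map_smul : ∀ (f : SmoothFunction n M) (X : SmoothVectorField n M) (s : SmoothSection n L),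
    toFun (X.smul f) s = f.toComplex • toFun X s
  leibniz : ∀ (X : SmoothVectorField n M) (g : ComplexSmoothFunction n M)
    (s : SmoothSection n L) (x : M),
    toFun X (g • s) x = mvfderiv (𝓡 (2 * n)) g x (X x) • s x + g x • toFun X s x

/-- The curvature `R(X, Y) = i (∇_X ∇_Y - ∇_Y ∇_X - ∇_{[X, Y]})`. -/
noncomputable def Connection.curvature (D : Connection n L) (X Y : SmoothVectorField n M) :
    Module.End ℂ (SmoothSection n L) :=
  Complex.I • (D.toFun X ∘ₗ D.toFun Y - D.toFun Y ∘ₗ D.toFun X - D.toFun (X.bracket Y))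

/-- The prequantum condition `R = Ω / ℏ`, where a function is identified with the endomorphism of
`L` that multiplies by it. -/
def Connection.IsPrequantum (D : Connection n L) (Ω : SymplecticForm n M) (hbar : ℝ) : Prop :=
  ∀ (X Y : SmoothVectorField n M) (s : SmoothSection n L) (x : M),
    D.curvature X Y s x = ((Ω.toFun x (X x) (Y x) / hbar : ℝ) : ℂ) • s x

/-- A smooth section `s` is square-integrable if the integral of `h(s, s)` against the Liouville
volume form is finite. -/
def HermitianMetric.IsSquareIntegrable [MeasurableSpace M] (h : HermitianMetric n L)
    (Ω : SymplecticForm n M) (s : SmoothSection n L) : Prop :=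
  ∫⁻ x, ENNReal.ofReal (h.toFun x (s x) (s x)).re ∂Ω.liouvilleMeasure < ⊤

/-- The prequantum operator `Q(f) = -i ℏ ∇_{X_f} + f` on `Γ(M, L)`. -/
noncomputable def prequantumOperator (Ω : SymplecticForm n M) (D : Connection n L) (hbar : ℝ)
    (f : SmoothFunction n M) : Module.End ℂ (SmoothSection n L) :=
  (-(Complex.I * hbar)) • D.toFun (Ω.hamiltonianVectorField f) + mulOperator f

end LineBundle

end Prequantization

/-!
The prequantum operators are handled as elements of the algebra of operators on sections. The
Leibniz rule says `[∇_X, g] = X(g)` for the multiplication operator by `g`, and the curvature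
condition says `[∇_X, ∇_Y] = ∇_{[X, Y]} - (i/ℏ) Ω(X, Y)`. For Hamiltonian vector fields
`X_f(g) = {f, g}`, and `dΩ = 0` evaluated on `X_f`, `X_g` and a third field gives
`[X_f, X_g] = X_{f, g}`. In `[-iℏ∇_{X_f} + f, -iℏ∇_{X_g} + g]` the curvature therefore contributes
`iℏ{f, g}`, the two mixed commutators together `-2iℏ{f, g}`, and the total is
`-ℏ²∇_{X_{f, g}} - iℏ{f, g}`, which is `-iℏ` times the prequantum operator of `{f, g}`.
-/

namespace Prequantization

open Set Filter Topology VectorField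

section Manifold

variable {𝕜 : Type*} [NontriviallyNormedField 𝕜]
  {E : Type*} [NormedAddCommGroup E] [NormedSpace 𝕜 E]
  {H : Type*} [TopologicalSpace H] {I : ModelWithCorners 𝕜 E H}
  {M : Type*} [TopologicalSpace M] [ChartedSpace H M]
  {F : Type*} [NormedAddCommGroup F] [NormedSpace 𝕜 F]
  {f : M → F} {x : M} {m : ℕ∞ω}

lemma mvfderiv_clm_comp {F' : Type*} [NormedAddCommGroup F'] [NormedSpace 𝕜 F'] (A : F →L[𝕜] F')
    (hf : MDifferentiableAt I 𝓘(𝕜, F) f x) :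
    mvfderiv I (A ∘ f) x = A ∘L mvfderiv I f x := by
  rw [mvfderiv, mfderiv_comp x A.mdifferentiableAt hf, A.mfderiv_eq]
  rfl

lemma contDiffWithinAt_comp_extChartAt_symm (hf : ContMDiffAt I 𝓘(𝕜, F) m f x) :
    ContDiffWithinAt 𝕜 m (f ∘ (extChartAt I x).symm) (range I) (extChartAt I x x) :=
  (contMDiffAt_iff.1 hf).2

/-- The coordinate expression of the vector field `V` in the preferred chart at `x`, in terms of
which the Lie bracket of vector fields on `M` is computed. It is meaningful only on the target of
the chart. -/
noncomputable def inChart (I : ModelWithCorners 𝕜 E H) (V : ∀ y : M, TangentSpace I y) (x : M) :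
    E → E :=
  mpullbackWithin 𝓘(𝕜, E) I (extChartAt I x).symm V (range I)

section

variable [IsManifold I 1 M]

lemma fderivWithin_comp_extChartAt_symm_inChart (V : ∀ y : M, TangentSpace I y) {u : E}
    (hu : u ∈ (extChartAt I x).target)
    (hf : MDifferentiableAt I 𝓘(𝕜, F) f ((extChartAt I x).symm u)) :
    fderivWithin 𝕜 (f ∘ (extChartAt I x).symm) (range I) u (inChart I V x u)
      = mvfderiv I f ((extChartAt I x).symm u) (V ((extChartAt I x).symm u)) := by
  have hchain := mfderiv_comp_mfderivWithin u hf (mdifferentiableWithinAt_extChartAt_symm hu)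
    (I.uniqueMDiffOn u (extChartAt_target_subset_range x hu))
  obtain ⟨e, he⟩ := isInvertible_mfderivWithin_extChartAt_symm hu
  rw [← mfderivWithin_eq_fderivWithin, hchain, inChart, mpullbackWithin_apply, ← he,
    ContinuousLinearMap.inverse_equiv]
  exact congrArg (mfderiv I 𝓘(𝕜, F) f _) (e.apply_symm_apply _)

lemma fderivWithin_comp_extChartAt_symm_inChart_self (V : ∀ y : M, TangentSpace I y)
    (hf : MDifferentiableAt I 𝓘(𝕜, F) f x) :
    fderivWithin 𝕜 (f ∘ (extChartAt I x).symm) (range I) (extChartAt I x x)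
        (inChart I V x (extChartAt I x x))
      = mvfderiv I f x (V x) := by
  have h := fderivWithin_comp_extChartAt_symm_inChart (f := f) V (mem_extChartAt_target (I := I) x)
    (by rwa [extChartAt_to_inv x])
  rwa [extChartAt_to_inv x] at h

lemma mvfderiv_apply_comp_extChartAt_symm_eventuallyEq (V : ∀ y : M, TangentSpace I y)
    (hf : ContMDiffAt I 𝓘(𝕜, F) 1 f x) :
    (fun y ↦ mvfderiv I f y (V y)) ∘ (extChartAt I x).symm
      =ᶠ[𝓝[range I] extChartAt I x x]
        fun u ↦ fderivWithin 𝕜 (f ∘ (extChartAt I x).symm) (range I) u (inChart I V x u) := by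
  have hf_near : ∀ᶠ u in 𝓝[range I] extChartAt I x x,
      ContMDiffAt I 𝓘(𝕜, F) 1 f ((extChartAt I x).symm u) := by
    have hfx : ∀ᶠ y in 𝓝 ((extChartAt I x).symm (extChartAt I x x)),
        ContMDiffAt I 𝓘(𝕜, F) 1 f y := by
      rw [extChartAt_to_inv x]
      exact (contMDiffAt_iff_contMDiffAt_nhds (by simp)).1 hf
    exact ((continuousAt_extChartAt_symm x).eventually hfx).filter_mono nhdsWithin_le_nhds
  filter_upwards [hf_near, extChartAt_target_mem_nhdsWithin x] with u hfu hu
  exact (fderivWithin_comp_extChartAt_symm_inChart V hu (hfu.mdifferentiableAt one_ne_zero)).symm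

lemma mlieBracket_eq_lieBracketWithin_inChart (V W : ∀ y : M, TangentSpace I y) (x : M) :
    mlieBracket I V W x
      = lieBracketWithin 𝕜 (inChart I V x) (inChart I W x) (range I) (extChartAt I x x) := by
  have hid : (mfderiv I 𝓘(𝕜, E) (extChartAt I x) x).inverse = ContinuousLinearMap.id 𝕜 E := by
    rw [mfderiv_extChartAt_self]
    exact ContinuousLinearMap.inverse_id
  rw [mlieBracket, mlieBracketWithin_apply, preimage_univ, univ_inter]
  exact DFunLike.congr_fun hid _

end

variable [IsManifold I 2 M] [CompleteSpace E] {V W : ∀ y : M, TangentSpace I y}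

lemma differentiableWithinAt_inChart
    (hV : MDifferentiableAt I I.tangent (fun y ↦ (V y : TangentBundle I M)) x) :
    DifferentiableWithinAt 𝕜 (inChart I V x) (range I) (extChartAt I x x) := by
  simpa only [preimage_univ, univ_inter, inChart] using
    hV.mdifferentiableWithinAt.differentiableWithinAt_mpullbackWithin_vectorField (s := univ)

lemma mdifferentiableAt_mvfderiv_apply (hf : ContMDiffAt I 𝓘(𝕜, F) 2 f x)
    (hV : MDifferentiableAt I I.tangent (fun y ↦ (V y : TangentBundle I M)) x) :
    MDifferentiableAt I 𝓘(𝕜, F) (fun y ↦ mvfderiv I f y (V y)) x := by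
  have hdf : DifferentiableWithinAt 𝕜
      (fderivWithin 𝕜 (f ∘ (extChartAt I x).symm) (range I)) (range I) (extChartAt I x x) :=
    ((contDiffWithinAt_comp_extChartAt_symm hf).fderivWithin_right I.uniqueDiffOn (m := 1)
      (by norm_num) (mem_range_self _)).differentiableWithinAt one_ne_zero
  rw [← mdifferentiableWithinAt_univ]
  refine DifferentiableWithinAt.mdifferentiableWithinAt_of_comp_extChartAt_symm ?_
  rw [preimage_univ, univ_inter]
  exact (hdf.clm_apply (differentiableWithinAt_inChart hV)).congr_of_eventuallyEq_of_mem
    (mvfderiv_apply_comp_extChartAt_symm_eventuallyEq V (hf.of_le (by norm_num))) (mem_range_self _)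

lemma mvfderiv_mlieBracket (hf : ContMDiffAt I 𝓘(𝕜, F) m f x) (hm : minSmoothness 𝕜 2 ≤ m)
    (hV : MDifferentiableAt I I.tangent (fun y ↦ (V y : TangentBundle I M)) x)
    (hW : MDifferentiableAt I I.tangent (fun y ↦ (W y : TangentBundle I M)) x) :
    mvfderiv I f x (mlieBracket I V W x)
      = mvfderiv I (fun y ↦ mvfderiv I f y (W y)) x (V x)
        - mvfderiv I (fun y ↦ mvfderiv I f y (V y)) x (W x) := by
  have hf₂ : ContMDiffAt I 𝓘(𝕜, F) 2 f x := hf.of_le (le_minSmoothness.trans hm)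
  have second_derivative {X Y : ∀ y : M, TangentSpace I y}
      (hX : MDifferentiableAt I I.tangent (fun y ↦ (X y : TangentBundle I M)) x) :
      mvfderiv I (fun y ↦ mvfderiv I f y (X y)) x (Y x)
        = fderivWithin 𝕜 (fun u ↦ fderivWithin 𝕜 (f ∘ (extChartAt I x).symm) (range I) u
            (inChart I X x u)) (range I) (extChartAt I x x) (inChart I Y x (extChartAt I x x)) := by
    rw [← fderivWithin_comp_extChartAt_symm_inChart_self Y
        (mdifferentiableAt_mvfderiv_apply hf₂ hX),
      (mvfderiv_apply_comp_extChartAt_symm_eventuallyEq X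
        (hf₂.of_le one_le_two)).fderivWithin_eq_of_mem (mem_range_self _)]
  rw [second_derivative hW, second_derivative hV, (hf₂.mdifferentiableAt two_ne_zero).mvfderiv,
    mlieBracket_eq_lieBracketWithin_inChart]
  exact fderivWithin_apply_lieBracket (E := E) (V := inChart I V x) (W := inChart I W x)
    (contDiffWithinAt_comp_extChartAt_symm hf) hm I.uniqueDiffOn
    (I.range_subset_closure_interior (mem_range_self _)) (mem_range_self _)
    (differentiableWithinAt_inChart hW) (differentiableWithinAt_inChart hV)

end Manifold

section Extension

variable {E : Type*} [NormedAddCommGroup E] [NormedSpace ℝ E] [FiniteDimensional ℝ E]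
  {H : Type*} [TopologicalSpace H] {I : ModelWithCorners ℝ E H}
  {M : Type*} [TopologicalSpace M] [ChartedSpace H M] [IsManifold I ∞ M] [T2Space M]
  {F : Type*} [NormedAddCommGroup F] [NormedSpace ℝ F]
  {V : M → Type*} [TopologicalSpace (Bundle.TotalSpace F V)] [∀ x, AddCommGroup (V x)]
  [∀ x, Module ℝ (V x)] [∀ x, TopologicalSpace (V x)] [FiberBundle F V] [VectorBundle ℝ F V]
  [ContMDiffVectorBundle ∞ F V I]

lemma exists_contMDiffSection_apply_eq (x : M) (v : V x) : ∃ s : Cₛ^∞⟮I; F, V⟯, s x = v := by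
  obtain ⟨U, hU, hσ⟩ := FiberBundle.exists_contMDiffOn_extend (k := ∞) I F v
  obtain ⟨U', hU'U, hU'_open, hxU'⟩ := mem_nhds_iff.1 hU
  obtain ⟨b, -, hb⟩ := (SmoothBumpFunction.nhds_basis_tsupport (I := I) x).mem_iff.1
    (hU'_open.mem_nhds hxU')
  refine ⟨⟨_, (b.contMDiff.contMDiffOn).smul_section_of_tsupport hU'_open hb (hσ.mono hU'U)⟩, ?_⟩
  change b x • FiberBundle.extend F v x = v
  rw [b.eq_one, one_smul, FiberBundle.extend_apply_self]

end Extension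

section Hamiltonian

variable {n : ℕ} {M : Type*} [TopologicalSpace M] [ChartedSpace (ModelSpace n) M]

lemma SmoothFunction.mvfderiv_toComplex (f : SmoothFunction n M) (x : M) :
    mvfderiv (𝓡 (2 * n)) f.toComplex x = Complex.ofRealCLM ∘L mvfderiv (𝓡 (2 * n)) f x :=
  mvfderiv_clm_comp Complex.ofRealCLM (f.contMDiff.mdifferentiableAt (by simp))

variable [IsManifold (𝓡 (2 * n)) ∞ M]

/-- The derivative `X(f) = df(X)` of a smooth function along a vector field, again as a smooth
function, so that vector fields act as operators on `C^∞(M, ℝ)`. -/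
noncomputable def SmoothVectorField.derivative (X : SmoothVectorField n M)
    (f : SmoothFunction n M) : SmoothFunction n M :=
  ⟨fun x ↦ mvfderiv (𝓡 (2 * n)) f x (X x), fun x ↦ by
    have h : ContMDiff (𝓡 (2 * n)) ((𝓡 (2 * n)).prod 𝓘(ℝ, ℝ)) ∞ fun x ↦
        Bundle.TotalSpace.mk' ℝ (E := Bundle.Trivial M ℝ) x (mvfderiv (𝓡 (2 * n)) f x (X x)) :=
      ContMDiff.clm_bundle_apply (F₁ := ModelSpace n) (contMDiff_mvfderiv f) X.contMDiff
    exact (Bundle.contMDiffAt_totalSpace.1 (h x)).2⟩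

namespace SmoothVectorField

variable (X Y : SmoothVectorField n M) (f : SmoothFunction n M)

lemma derivative_neg : X.derivative (-f) = -X.derivative f :=
  ContMDiffMap.ext fun x ↦ by
    change mvfderiv (𝓡 (2 * n)) (-⇑f) x (X x) = -mvfderiv (𝓡 (2 * n)) f x (X x)
    rw [mvfderiv_neg, neg_apply]

lemma derivative_bracket :
    (X.bracket Y).derivative f
      = X.derivative (Y.derivative f) - Y.derivative (X.derivative f) :=
  haveI : IsManifold (𝓡 (2 * n)) 2 M := .of_le (n := ∞) (by simpa using ENat.LEInfty.out)
  ContMDiffMap.ext fun x ↦ mvfderiv_mlieBracket (f.contMDiff x)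
    (by simpa using ENat.LEInfty.out) ((X.contMDiff x).mdifferentiableAt (by simp))
    ((Y.contMDiff x).mdifferentiableAt (by simp))

end SmoothVectorField

namespace SymplecticForm

variable (Ω : SymplecticForm n M)

lemma toFun_swap (x : M) (v w : TangentSpace (𝓡 (2 * n)) x) :
    Ω.toFun x v w = -Ω.toFun x w v := by
  have h := Ω.alternating x (v + w)
  simp only [map_add, add_apply, Ω.alternating, zero_add, add_zero] at h
  exact eq_neg_of_add_eq_zero_right h

lemma apply_hamiltonianVectorField_right (f : SmoothFunction n M) (x : M)
    (v : TangentSpace (𝓡 (2 * n)) x) :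
    Ω.toFun x v (Ω.hamiltonianVectorField f x) = mvfderiv (𝓡 (2 * n)) f x v := by
  rw [Ω.toFun_swap, Ω.hamiltonianVectorField_spec, neg_neg]

lemma derivative_hamiltonianVectorField (f g : SmoothFunction n M) :
    (Ω.hamiltonianVectorField f).derivative g = Ω.poissonBracket f g :=
  ContMDiffMap.ext fun x ↦ (Ω.apply_hamiltonianVectorField_right g x _).symm

lemma poissonBracket_swap (f g : SmoothFunction n M) :
    Ω.poissonBracket g f = -Ω.poissonBracket f g :=
  ContMDiffMap.ext fun x ↦ Ω.toFun_swap x _ _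

lemma apply_bracket_hamiltonianVectorField (f g : SmoothFunction n M) (Z : SmoothVectorField n M)
    (x : M) :
    Ω.toFun x ((Ω.hamiltonianVectorField f).bracket (Ω.hamiltonianVectorField g) x) (Z x)
      = -Z.derivative (Ω.poissonBracket f g) x := by
  set X := Ω.hamiltonianVectorField f
  set Y := Ω.hamiltonianVectorField g
  have apply_bracket_right (W : SmoothVectorField n M) (k : SmoothFunction n M) :
      Ω.toFun x (W.bracket Z x) (Ω.hamiltonianVectorField k x)
        = W.derivative (Z.derivative k) x - Z.derivative (W.derivative k) x :=
    (Ω.apply_hamiltonianVectorField_right k x _).trans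
      (DFunLike.congr_fun (W.derivative_bracket Z k) x)
  have derivative_apply_left (W : SmoothVectorField n M) (k : SmoothFunction n M) :
      mvfderiv (𝓡 (2 * n)) (fun y ↦ Ω.toFun y (Ω.hamiltonianVectorField k y) (Z y)) x (W x)
        = -W.derivative (Z.derivative k) x := by
    simp only [Ω.hamiltonianVectorField_spec, mvfderiv_fun_neg]
    rfl
  have hXg : X.derivative g = Ω.poissonBracket f g := Ω.derivative_hamiltonianVectorField f g
  have hYf : Y.derivative f = -Ω.poissonBracket f g :=
    (Ω.derivative_hamiltonianVectorField g f).trans (Ω.poissonBracket_swap f g)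
  have derivative_apply_both :
      mvfderiv (𝓡 (2 * n)) (fun y ↦ Ω.toFun y (X y) (Y y)) x (Z x)
        = Z.derivative (Ω.poissonBracket f g) x := rfl
  have h := Ω.closed X Y Z x
  rw [derivative_apply_left, derivative_apply_left, derivative_apply_both, apply_bracket_right,
    apply_bracket_right, hXg, hYf, Z.derivative_neg, ContMDiffMap.coe_neg, Pi.neg_apply] at h
  linarith

lemma bracket_hamiltonianVectorField [T2Space M] (f g : SmoothFunction n M) :
    (Ω.hamiltonianVectorField f).bracket (Ω.hamiltonianVectorField g)
      = Ω.hamiltonianVectorField (Ω.poissonBracket f g) := by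
  refine ContMDiffSection.ext fun x ↦ sub_eq_zero.1 (Ω.nondegenerate x _ fun w ↦ ?_)
  obtain ⟨Z, rfl⟩ := exists_contMDiffSection_apply_eq (I := 𝓡 (2 * n)) (F := ModelSpace n) x w
  rw [map_sub, sub_apply, Ω.hamiltonianVectorField_spec, sub_eq_zero]
  exact Ω.apply_bracket_hamiltonianVectorField f g Z x

end SymplecticForm

end Hamiltonian

section LineBundle

variable {n : ℕ} {M : Type*} [TopologicalSpace M] [ChartedSpace (ModelSpace n) M]
  {L : M → Type*} [∀ x, AddCommGroup (L x)] [∀ x, Module ℂ (L x)] [∀ x, TopologicalSpace (L x)]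
  [TopologicalSpace (Bundle.TotalSpace ℂ L)] [FiberBundle ℂ L] [VectorBundle ℂ ℂ L]
  [IsManifold (𝓡 (2 * n)) ∞ M] [VectorBundle ℝ ℂ L] [ContMDiffVectorBundle ∞ ℂ L (𝓡 (2 * n))]

lemma mulOperator_neg (f : SmoothFunction n M) :
    mulOperator (L := L) (-f) = -mulOperator f :=
  LinearMap.ext fun s ↦ ContMDiffSection.ext fun x ↦ by
    change ((-f x : ℝ) : ℂ) • s x = -((f x : ℂ) • s x)
    rw [Complex.ofReal_neg, neg_smul]

lemma lie_mulOperator_mulOperator (f g : SmoothFunction n M) :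
    ⁅mulOperator (L := L) f, mulOperator (L := L) g⁆ = 0 :=
  LinearMap.ext fun s ↦ ContMDiffSection.ext fun x ↦
    sub_eq_zero.2 (smul_comm (f x : ℂ) (g x : ℂ) (s x))

namespace Connection

lemma lie_toFun_mulOperator (D : Connection n L) (X : SmoothVectorField n M)
    (f : SmoothFunction n M) :
    ⁅D.toFun X, mulOperator (L := L) f⁆ = mulOperator (X.derivative f) :=
  LinearMap.ext fun s ↦ ContMDiffSection.ext fun x ↦ by
    have h := D.leibniz X f.toComplex s x
    rw [f.mvfderiv_toComplex] at h
    exact sub_eq_of_eq_add h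

namespace IsPrequantum

variable {D : Connection n L} {Ω : SymplecticForm n M} {hbar : ℝ}

lemma lie_toFun_apply (hD : D.IsPrequantum Ω hbar) (X Y : SmoothVectorField n M)
    (s : SmoothSection n L) (x : M) :
    ⁅D.toFun X, D.toFun Y⁆ s x
      = D.toFun (X.bracket Y) s x - (Complex.I / hbar) • (Ω.toFun x (X x) (Y x) : ℂ) • s x := by
  have h : Complex.I • (⁅D.toFun X, D.toFun Y⁆ s x - D.toFun (X.bracket Y) s x)
      = ((Ω.toFun x (X x) (Y x) / hbar : ℝ) : ℂ) • s x := hD X Y s x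
  have h' : ⁅D.toFun X, D.toFun Y⁆ s x - D.toFun (X.bracket Y) s x
      = -Complex.I • ((Ω.toFun x (X x) (Y x) / hbar : ℝ) : ℂ) • s x := by
    rw [← h, smul_smul, neg_mul, Complex.I_mul_I, neg_neg, one_smul]
  rw [sub_eq_iff_eq_add'.1 h', Complex.ofReal_div]
  module

lemma lie_toFun_hamiltonianVectorField [T2Space M] (hD : D.IsPrequantum Ω hbar)
    (f g : SmoothFunction n M) :
    ⁅D.toFun (Ω.hamiltonianVectorField f), D.toFun (Ω.hamiltonianVectorField g)⁆
      = D.toFun (Ω.hamiltonianVectorField (Ω.poissonBracket f g))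
        - (Complex.I / hbar) • mulOperator (Ω.poissonBracket f g) :=
  LinearMap.ext fun s ↦ ContMDiffSection.ext fun x ↦ by
    rw [hD.lie_toFun_apply, Ω.bracket_hamiltonianVectorField]
    rfl

end IsPrequantum

end Connection

section

attribute [local instance] LieRing.ofAssociativeRing

lemma lie_prequantumOperator (Ω : SymplecticForm n M) (D : Connection n L) (hbar : ℝ)
    (f g : SmoothFunction n M) :
    ⁅prequantumOperator Ω D hbar f, prequantumOperator Ω D hbar g⁆
      = (-(hbar : ℂ) ^ 2) •
          ⁅D.toFun (Ω.hamiltonianVectorField f), D.toFun (Ω.hamiltonianVectorField g)⁆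
        - (2 * Complex.I * hbar) • mulOperator (Ω.poissonBracket f g) := by
  have lie_mulOperator_toFun (f : SmoothFunction n M) (X : SmoothVectorField n M) :
      ⁅mulOperator (L := L) f, D.toFun X⁆ = -mulOperator (X.derivative f) := by
    rw [← lie_skew, D.lie_toFun_mulOperator]
  simp only [prequantumOperator, add_lie, lie_add, smul_lie, lie_smul,
    lie_mulOperator_toFun, D.lie_toFun_mulOperator, lie_mulOperator_mulOperator,
    Ω.derivative_hamiltonianVectorField, Ω.poissonBracket_swap f g, mulOperator_neg]
  match_scalars
  · linear_combination (hbar : ℂ) ^ 2 * Complex.I_sq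
  · ring

end

end LineBundle

end Prequantization

open Prequantization in
theorem mainTheorem8_general {n : ℕ} {M : Type*} [TopologicalSpace M] [T2Space M]
    [ChartedSpace (ModelSpace n) M] [IsManifold (𝓡 (2 * n)) ∞ M]
    {L : M → Type*} [∀ x, AddCommGroup (L x)] [∀ x, Module ℂ (L x)]
    [∀ x, TopologicalSpace (L x)] [TopologicalSpace (Bundle.TotalSpace ℂ L)] [FiberBundle ℂ L]
    [VectorBundle ℂ ℂ L] [VectorBundle ℝ ℂ L] [ContMDiffVectorBundle ∞ ℂ L (𝓡 (2 * n))]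
    (Ω : SymplecticForm n M) (D : Connection n L) (hbar : ℝ) (hbar_ne : hbar ≠ 0)
    (hD : D.IsPrequantum Ω hbar) (f g : SmoothFunction n M) :
    (Complex.I / hbar) • ⁅prequantumOperator Ω D hbar f, prequantumOperator Ω D hbar g⁆
      = prequantumOperator Ω D hbar (Ω.poissonBracket f g) := by
  have hbar_ne' : (hbar : ℂ) ≠ 0 := Complex.ofReal_ne_zero.2 hbar_ne
  rw [lie_prequantumOperator, hD.lie_toFun_hamiltonianVectorField, prequantumOperator]
  match_scalars
  · field_simp
  · field_simp
    linear_combination -Complex.I_sq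

theorem mainTheorem8 {n : ℕ} {M : Type*} [TopologicalSpace M] [T2Space M]
    [SecondCountableTopology M] [ChartedSpace (Prequantization.ModelSpace n) M]
    [IsManifold (𝓡 (2 * n)) ∞ M] [MeasurableSpace M] [BorelSpace M]
    {L : M → Type*} [∀ x, AddCommGroup (L x)] [∀ x, Module ℂ (L x)]
    [∀ x, TopologicalSpace (L x)] [TopologicalSpace (Bundle.TotalSpace ℂ L)] [FiberBundle ℂ L]
    [VectorBundle ℂ ℂ L] [VectorBundle ℝ ℂ L] [ContMDiffVectorBundle ∞ ℂ L (𝓡 (2 * n))]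
    (Ω : Prequantization.SymplecticForm n M) (h : Prequantization.HermitianMetric n L)
    (D : Prequantization.Connection n L) (hbar : ℝ) (hbar_pos : 0 < hbar)
    (hD : D.IsPrequantum Ω hbar) (f g : Prequantization.SmoothFunction n M)
    (s : Prequantization.SmoothSection n L) (hs : h.IsSquareIntegrable Ω s) :
    (Complex.I / hbar) • ⁅Prequantization.prequantumOperator Ω D hbar f,
        Prequantization.prequantumOperator Ω D hbar g⁆ s
      = Prequantization.prequantumOperator Ω D hbar (Ω.poissonBracket f g) s :=
  LinearMap.congr_fun (mainTheorem8_general Ω D hbar hbar_pos.ne' hD f g) s
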